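/- Let $\Gamma$ be a countable discrete group and let $\mu$ be a probability measure on $\Gamma$. Conventions. Let $\mathbb P_\mu$ be the law on $\Gamma^{\mathbb N}$ of the random walk $\omega_0=e$, $\omega_n=g_1g_2\cdots g_n$, where the increments $g_i$ are independent with law $\mu$. A measure $\nu$ on a $\Gamma$-space is $\mu$-stationary if $\nu=\sum_{g\in\Gamma}\mu(g)\,g\nu$. Compact spaces are Hausdorff, $\Gamma$ acts on them by homeomorphisms, and Borel probability measures on them are taken to be regular. A compact model of a non-singular measurable action $\Gamma\curvearrowright(X,\nu)$ on a probability space is a compact $\Gamma$-space $K$ with a Borel probability measure $\bar\nu$ such that $(X,\nu)$ and $(K,\bar\nu)$ are isomorphic as measured $\Gamma$-spaces (modulo null sets). The action $\Gamma\curvearrowright(X,\nu)$ is a $\mu$-boundary if it is non-singular and $\mu$-stationary and has a compact metrizable model $(M,\eta)$ such that $\eta$ is $\mu$-stationary and, for $\mathbb P_\mu$-almost every path $\omega$, the measures $\omega_n\eta$ converge weak* to a Dirac measure. It is a $\mu$-USB if it is a $\mu$-boundary and has a compact (not necessarily metrizable) model $(K,\bar\nu)$ such that $\bar\nu$ is the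 unique $\mu$-stationary Borel probability measure on $K$. It is essentially free if $\nu(\{x: gx=x\})=0$ for every $g\neq e$. Let $\lambda$ be the left regular representation of $\Gamma$ on $\ell^2(\Gamma)$, let $C^*_\lambda(\Gamma)\subset \mathcal B(\ell^2(\Gamma))$ be the norm closure of the linear span of $\{\lambda_g: g\in\Gamma\}$, and let $\tau_0(a)=\langle a\delta_e,\delta_e\rangle$ be its canonical trace. A state $\tau$ on $C^*_\lambda(\Gamma)$ is $\mu$-stationary if $\tau(a)=\sum_{g\in\Gamma}\mu(g)\,\tau(\lambda_g^{*}a\lambda_g)$ for all $a\in C^*_\lambda(\Gamma)$. Theorem. If $\Gamma$ admits an essentially free $\mu$-USB, then $\tau_0$ is the unique $\mu$-stationary state on $C^*_\lambda(\Gamma)$, i.e. $\mu$ is $C^*$-simple. -/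

import Mathlib

open MeasureTheory Filter Topology
open scoped ENNReal

universe u v w z

noncomputable section

/-! ## Random walks, stationary measures, boundaries -/

section Walk

variable {Γ : Type*} [Group Γ]

/-- The position `g₁ g₂ ⋯ gₙ` after `n` steps of the walk started at the identity, where the
increments are `g₁ = s 0`, `g₂ = s 1`, … -/
def walkPosition (s : ℕ → Γ) : ℕ → Γ
  | 0 => 1
  | n + 1 => walkPosition s n * s n

variable [MeasurableSpace Γ]

/-- The path measure of the `(Γ, μ)`-random walk on `Γ^ℕ`: the law of the sequence of positions
when the increments are independent with law `μ`. -/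
def pathMeasure (μ : PMF Γ) : Measure (ℕ → Γ) :=
  (Measure.infinitePi fun _ : ℕ => μ.toMeasure).map walkPosition

theorem measurable_walkPosition [Countable Γ] [DiscreteMeasurableSpace Γ] :
    Measurable (walkPosition : (ℕ → Γ) → ℕ → Γ) := by
  refine measurable_pi_lambda _ fun n => ?_
  induction n with
  | zero => exact measurable_const
  | succ n ih =>
    exact (measurable_from_prod_countable_left (f := fun p : Γ × Γ => p.1 * p.2)
      fun _ => measurable_of_countable _).comp (ih.prodMk (measurable_pi_apply n))

instance [Countable Γ] [DiscreteMeasurableSpace Γ] (μ : PMF Γ) :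
    IsProbabilityMeasure (pathMeasure μ) :=
  Measure.isProbabilityMeasure_map measurable_walkPosition.aemeasurable

end Walk

section Actions

/-- A measure `ν` is `μ`-stationary: `ν = ∑_g μ(g) gν`. -/
def IsStationaryMeasure {Γ : Type u} [Group Γ] (μ : PMF Γ) {X : Type v} [MeasurableSpace X]
    [MulAction Γ X] (ν : Measure X) : Prop :=
  Measure.sum (fun g : Γ => μ g • ν.map (fun x => g • x)) = ν

/-- The action is non-singular: `gν` and `ν` have the same null sets, for every `g`. -/
def IsNonsingularAction (Γ : Type u) [Group Γ] {X : Type v} [MeasurableSpace X]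
    [MulAction Γ X] (ν : Measure X) : Prop :=
  ∀ g : Γ, ν.map (fun x => g • x) ≪ ν ∧ ν ≪ ν.map (fun x => g • x)

/-- The action is essentially free: the fixed point set of every nontrivial element is null. -/
def IsEssentiallyFree (Γ : Type u) [Group Γ] {X : Type v} [MeasurableSpace X]
    [MulAction Γ X] (ν : Measure X) : Prop :=
  ∀ g : Γ, g ≠ 1 → ν {x | g • x = x} = 0

/-- Isomorphism of measured `Γ`-spaces (modulo null sets): measurable maps in both directions
that are inverse to each other almost everywhere, transport `ν` to `η`, and are
`Γ`-equivariant almost everywhere. -/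
def IsoMeasuredAction (Γ : Type u) [Group Γ]
    {X : Type v} [MeasurableSpace X] [MulAction Γ X] (ν : Measure X)
    {Y : Type w} [MeasurableSpace Y] [MulAction Γ Y] (η : Measure Y) : Prop :=
  ∃ (φ : X → Y) (ψ : Y → X), Measurable φ ∧ Measurable ψ ∧ ν.map φ = η ∧
    (∀ᵐ x ∂ν, ψ (φ x) = x) ∧ (∀ᵐ y ∂η, φ (ψ y) = y) ∧
    ∀ g : Γ, ∀ᵐ x ∂ν, φ (g • x) = g • φ x

/-- Boundary actions on a compact metrizable `Γ`-space: `ν` is `μ`-stationary and, for almost every path `ω`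
of the random walk, `ω_n ν` converges weak* to a Dirac measure. -/
def IsTopologicalModelBoundary {Γ : Type u} [Group Γ] [MeasurableSpace Γ] (μ : PMF Γ)
    {X : Type v} [TopologicalSpace X] [MeasurableSpace X] [MulAction Γ X]
    (ν : Measure X) : Prop :=
  IsStationaryMeasure μ ν ∧
    ∀ᵐ ω ∂(pathMeasure μ), ∃ x : X, ∀ f : C(X, ℝ),
      Tendsto (fun n : ℕ => ∫ y, f y ∂(ν.map (fun y => ω n • y))) atTop
        (𝓝 (∫ y, f y ∂(Measure.dirac x)))

/-- Measurable `μ`-boundary actions: non-singular `μ`-stationary actions on a probability space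
that admit a compact metrizable model which is a `μ`-boundary in the topological sense. -/
def IsBoundaryAction {Γ : Type u} [Group Γ] [MeasurableSpace Γ] (μ : PMF Γ)
    {X : Type v} [MeasurableSpace X] [MulAction Γ X] (ν : Measure X) : Prop :=
  IsProbabilityMeasure ν ∧ IsNonsingularAction Γ ν ∧ IsStationaryMeasure μ ν ∧
    ∃ (M : Type w) (_ : TopologicalSpace M) (_ : CompactSpace M)
      (_ : TopologicalSpace.MetrizableSpace M) (_ : MeasurableSpace M) (_ : BorelSpace M)
      (_ : MulAction Γ M) (_ : ContinuousConstSMul Γ M) (η : Measure M),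
      IsProbabilityMeasure η ∧ IsoMeasuredAction Γ ν η ∧ IsTopologicalModelBoundary μ η

/-- `η` is the unique `μ`-stationary (regular) Borel probability measure on the compact
`Γ`-space `K`. -/
def IsUniqueStationaryMeasure {Γ : Type u} [Group Γ] (μ : PMF Γ)
    {K : Type w} [TopologicalSpace K] [MeasurableSpace K] [MulAction Γ K]
    (η : Measure K) : Prop :=
  (IsProbabilityMeasure η ∧ η.Regular ∧ IsStationaryMeasure μ η) ∧
    ∀ η' : Measure K, IsProbabilityMeasure η' → η'.Regular → IsStationaryMeasure μ η' → η' = η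

/-- A `μ`-USB: a measurable `μ`-boundary action having a compact (Hausdorff, not necessarily
metrizable) model which carries a unique `μ`-stationary probability measure. -/
def IsUSB {Γ : Type u} [Group Γ] [MeasurableSpace Γ] (μ : PMF Γ)
    {X : Type v} [MeasurableSpace X] [MulAction Γ X] (ν : Measure X) : Prop :=
  IsBoundaryAction.{u, v, w} μ ν ∧
    ∃ (K : Type z) (_ : TopologicalSpace K) (_ : CompactSpace K) (_ : T2Space K)
      (_ : MeasurableSpace K) (_ : BorelSpace K)
      (_ : MulAction Γ K) (_ : ContinuousConstSMul Γ K) (η : Measure K),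
      IsoMeasuredAction Γ ν η ∧ IsUniqueStationaryMeasure μ η

end Actions

/-! ## The reduced group C*-algebra -/

section Reduced

/-- The Hilbert space `ℓ²(Γ)`. -/
abbrev EllTwo (Γ : Type*) : Type _ := lp (fun _ : Γ => ℂ) 2

variable {Γ : Type*} [Group Γ]

theorem memlp_translate (g : Γ) (ξ : EllTwo Γ) :
    Memℓp (fun h : Γ => ξ (g⁻¹ * h)) 2 := by
  have h2 : (0 : ℝ) < (2 : ℝ≥0∞).toReal := by norm_num
  have h := (memℓp_gen_iff h2).1 (lp.memℓp ξ)
  exact (memℓp_gen_iff h2).2 ((Equiv.mulLeft g⁻¹).summable_iff.2 h)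

/-- The operator `(λ_g ξ)(h) = ξ(g⁻¹ h)` on `ℓ²(Γ)`. -/
def leftTranslation (g : Γ) : EllTwo Γ →L[ℂ] EllTwo Γ :=
  LinearIsometry.toContinuousLinearMap
    { toFun := fun ξ => ⟨fun h : Γ => ξ (g⁻¹ * h), memlp_translate g ξ⟩
      map_add' := fun _ _ => rfl
      map_smul' := fun _ _ => rfl
      norm_map' := fun ξ => by
        have h2 : (0 : ℝ) < (2 : ℝ≥0∞).toReal := by norm_num
        rw [lp.norm_eq_tsum_rpow h2, lp.norm_eq_tsum_rpow h2]
        congr 1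
        exact (Equiv.mulLeft g⁻¹).tsum_eq fun h => ‖ξ h‖ ^ (2 : ℝ≥0∞).toReal }

@[simp] theorem leftTranslation_apply (g : Γ) (ξ : EllTwo Γ) (h : Γ) :
    leftTranslation g ξ h = ξ (g⁻¹ * h) := rfl

theorem leftTranslation_one : leftTranslation (1 : Γ) = 1 := by
  ext ξ h; simp

theorem leftTranslation_mul (g h : Γ) :
    leftTranslation (g * h) = leftTranslation g * leftTranslation h := by
  ext ξ k; simp [mul_assoc]

theorem star_leftTranslation (g : Γ) : star (leftTranslation g) = leftTranslation g⁻¹ := by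
  rw [ContinuousLinearMap.star_eq_adjoint, eq_comm, ContinuousLinearMap.eq_adjoint_iff]
  intro ξ η
  rw [lp.inner_eq_tsum, lp.inner_eq_tsum,
    ← (Equiv.mulLeft g).tsum_eq fun h => inner ℂ (ξ h) (leftTranslation g η h)]
  simp

variable (Γ)

/-- The reduced C*-algebra `C*_λ(Γ)`: the norm closure in `B(ℓ²(Γ))` of the *-algebra generated
by (equivalently, of the linear span of) the operators `λ_g`. -/
def ReducedCStar : StarSubalgebra ℂ (EllTwo Γ →L[ℂ] EllTwo Γ) :=
  (StarAlgebra.adjoin ℂ (Set.range (leftTranslation (Γ := Γ)))).topologicalClosure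

variable {Γ}

theorem leftTranslation_mem (g : Γ) : leftTranslation g ∈ ReducedCStar Γ :=
  StarSubalgebra.le_topologicalClosure _ (StarAlgebra.subset_adjoin ℂ _ ⟨g, rfl⟩)

/-- The left regular representation, as a homomorphism to the unitary group of `C*_λ(Γ)`. -/
def leftRegular : Γ →* unitary (ReducedCStar Γ) where
  toFun g := ⟨⟨leftTranslation g, leftTranslation_mem g⟩, by
    rw [Unitary.mem_iff]
    constructor <;> apply Subtype.ext <;>
      simp [star_leftTranslation, ← leftTranslation_mul, leftTranslation_one]⟩
  map_one' := by
    apply Subtype.ext; apply Subtype.ext; exact leftTranslation_one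
  map_mul' g h := by
    apply Subtype.ext; apply Subtype.ext; exact leftTranslation_mul g h

/-- The action of `Γ` on `C*_λ(Γ)` by inner automorphisms, `g · a = λ_g a λ_g*`. -/
def innerAction : Γ →* (ReducedCStar Γ ≃⋆ₐ[ℂ] ReducedCStar Γ) :=
  (Unitary.conjStarAlgAut ℂ (ReducedCStar Γ)).comp leftRegular

open Classical in
/-- The canonical trace `τ₀(a) = (a δ_e)(e)`; it satisfies `τ₀(∑ c_g λ_g) = c_e`. -/
def canonicalTrace : ReducedCStar Γ →ₗ[ℂ] ℂ where
  toFun a := (a : EllTwo Γ →L[ℂ] EllTwo Γ) (lp.single 2 (1 : Γ) (1 : ℂ)) 1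
  map_add' _ _ := rfl
  map_smul' _ _ := rfl

open Classical in
theorem canonicalTrace_leftRegular (g : Γ) :
    canonicalTrace (leftRegular g : ReducedCStar Γ) = if g = 1 then 1 else 0 := by
  change (lp.single 2 (1 : Γ) (1 : ℂ) : EllTwo Γ) (g⁻¹ * 1) = _
  by_cases hg : g = 1
  · subst hg; simp
  · rw [lp.single_apply_ne _ _ _ (by simpa using hg)]; simp [hg]

end Reduced

/-! ## States and stationary states -/

section States

open scoped ComplexOrder in
/-- A state on a unital C*-algebra: a unital positive linear functional. -/
def IsState {A : Type*} [CStarAlgebra A] (φ : A →ₗ[ℂ] ℂ) : Prop :=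
  φ 1 = 1 ∧ ∀ a : A, 0 ≤ φ (star a * a)

/-- A functional `φ` on a `Γ`-C*-algebra is `μ`-stationary: `φ = ∑_g μ(g) gφ`, where
`(gφ)(a) = φ(g⁻¹ a)`. -/
def IsStationaryFunctional {Γ : Type*} [Group Γ] (μ : PMF Γ) {A : Type*} [CStarAlgebra A]
    (α : Γ →* (A ≃⋆ₐ[ℂ] A)) (φ : A →ₗ[ℂ] ℂ) : Prop :=
  ∀ a : A, HasSum (fun g : Γ => ((μ g).toReal : ℂ) * φ (α g⁻¹ a)) (φ a)

instance {Γ : Type*} [Group Γ] :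
    IsClosed (ReducedCStar Γ : Set (EllTwo Γ →L[ℂ] EllTwo Γ)) :=
  StarSubalgebra.isClosed_topologicalClosure _

/-- `μ` is C*-simple: the canonical trace is the unique `μ`-stationary state on `C*_λ(Γ)`, for
the action by inner automorphisms. -/
def IsCStarSimpleMeasure {Γ : Type*} [Group Γ] (μ : PMF Γ) : Prop :=
  (IsState (canonicalTrace (Γ := Γ)) ∧
    IsStationaryFunctional μ innerAction (canonicalTrace (Γ := Γ))) ∧
  ∀ φ : ReducedCStar Γ →ₗ[ℂ] ℂ, IsState φ → IsStationaryFunctional μ innerAction φ →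
    φ = canonicalTrace

end States

end

/-! Let `φ` be a stationary state and `g ≠ 1`; the point is that `φ(λ_g) = 0`. The function `Q(h) =
φ(h⁻¹ · λ_g)` is bounded and `μ`-harmonic, so `Q 1` is the mean of `Q (ω n)` for every `n`, and by
dominated convergence it suffices that `Q (ω n) → 0` along almost every path.

On the metrizable model `M`, `ω n • η` converges to a point mass at some `x`, and essential freeness
gives `g • x ≠ x` almost surely. A neighbourhood `U` of `x` displaced by `g` then carries almost all
of `ω n • η` (`ae_eventually_exists_displaced`).

To bring `φ` into play, extend it to a stationary state `ψ` on `B(ℓ²(Γ))`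
(`exists_stationary_extension`). An orbit map `h ↦ h • k` embeds functions on `K` as diagonal
operators, equivariantly, so `ψ` restricts to a stationary measure on `K`, which must be the unique
one (`integral_eq`). The set `U` passes through the measurable isomorphisms to a set in `K`, and
inner regularity replaces it by a continuous `f` with `f · (f ∘ g) = 0`. Then `f λ_g f = 0`, while
the translate of `ψ` by `ω n` nearly gives `f` the value `1`; Cauchy–Schwarz makes `Q (ω n)` small.
-/

/-! ## States on C*-algebras -/

section StatesOnCStarAlgebras

open scoped ComplexOrder

variable {A : Type*} [CStarAlgebra A]

/-- The Cauchy–Schwarz inequality for states. -/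
theorem IsState.norm_apply_star_mul_le {φ : A →ₗ[ℂ] ℂ} (hφ : IsState φ) (a b : A) :
    ‖φ (star b * a)‖ ≤ √(φ (star b * b)).re * √(φ (star a * a)).re := by
  let _ := CStarAlgebra.spectralOrder A
  let _ := CStarAlgebra.spectralOrderedRing A
  let f : A →ₚ[ℂ] ℂ := PositiveLinearMap.mk₀ φ fun x hx => by
    obtain ⟨s, rfl⟩ := CStarAlgebra.nonneg_iff_eq_star_mul_self.1 hx
    exact hφ.2 s
  exact norm_inner_le_norm (𝕜 := ℂ) (f.toPreGNS b) (f.toPreGNS a)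

theorem IsState.re_apply_star_mul_self_le {φ : A →ₗ[ℂ] ℂ} (hφ : IsState φ) (a : A) :
    (φ (star a * a)).re ≤ ‖a‖ ^ 2 := by
  let _ := CStarAlgebra.spectralOrder A
  let _ := CStarAlgebra.spectralOrderedRing A
  let f : A →ₚ[ℂ] ℂ := PositiveLinearMap.mk₀ φ fun x hx => by
    obtain ⟨s, rfl⟩ := CStarAlgebra.nonneg_iff_eq_star_mul_self.1 hx
    exact hφ.2 s
  have h := f.norm_apply_le_of_nonneg (star a * a) (star_mul_self_nonneg a)
  have h1 : f 1 = 1 := hφ.1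
  rw [h1, norm_one, one_mul, CStarRing.norm_star_mul_self, ← sq] at h
  exact (Complex.re_le_norm _).trans h

theorem IsState.norm_apply_le {φ : A →ₗ[ℂ] ℂ} (hφ : IsState φ) (a : A) : ‖φ a‖ ≤ ‖a‖ := by
  have h := hφ.norm_apply_star_mul_le a 1
  simp only [star_one, one_mul, hφ.1, Complex.one_re, Real.sqrt_one] at h
  exact h.trans (Real.sqrt_le_iff.2 ⟨norm_nonneg a, hφ.re_apply_star_mul_self_le a⟩)

/-- A state as a continuous functional. -/
noncomputable def IsState.toStrongDual {φ : A →ₗ[ℂ] ℂ} (hφ : IsState φ) : StrongDual ℂ A :=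
  φ.mkContinuous 1 fun a => by simpa using hφ.norm_apply_le a

theorem IsState.continuous {φ : A →ₗ[ℂ] ℂ} (hφ : IsState φ) : Continuous φ :=
  hφ.toStrongDual.continuous

/-- Contractive unital functionals are real on self-adjoint elements. -/
theorem im_apply_eq_zero_of_contractive {φ : A →ₗ[ℂ] ℂ} (h1 : φ 1 = 1)
    (hφ : ∀ a, ‖φ a‖ ≤ ‖a‖) {b : A} (hb : star b = b) : (φ b).im = 0 := by
  -- Adding `i t` raises the squared norm of `b` by at most `t²`, whereas the squared imaginary part
  -- of the value gains `2 t Im φ(b) + t²`.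
  have key : ∀ t : ℝ, 2 * (φ b).im * t ≤ ‖b‖ ^ 2 := fun t => by
    have hn := hφ (b + ((t : ℂ) * Complex.I) • 1)
    have h2 : ‖b + ((t : ℂ) * Complex.I) • (1 : A)‖ ^ 2 ≤ ‖b‖ ^ 2 + t ^ 2 := by
      rw [sq, ← CStarRing.norm_star_mul_self]
      have : star (b + ((t : ℂ) * Complex.I) • (1 : A)) * (b + ((t : ℂ) * Complex.I) • (1 : A))
          = star b * b + ((t : ℂ) ^ 2) • (1 : A) := by
        simp only [star_add, hb, star_smul, star_one, Complex.star_def, map_mul, Complex.conj_ofReal,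
          Complex.conj_I, add_mul, mul_add, smul_mul_assoc, mul_smul_comm, one_mul, mul_one,
          smul_add, smul_smul]
        have : (t : ℂ) * Complex.I * (t * -Complex.I) = t ^ 2 := by
          linear_combination (-(t : ℂ) ^ 2) * Complex.I_sq
        rw [this, mul_neg, neg_smul]
        abel
      rw [this]
      refine (norm_add_le _ _).trans ?_
      rw [CStarRing.norm_star_mul_self, ← sq]
      gcongr
      refine (norm_smul_le _ _).trans ?_
      have h1' : ‖(1 : A)‖ ≤ 1 := by
        rcases subsingleton_or_nontrivial A with h | h
        · simp [Subsingleton.elim (1 : A) 0]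
        · exact CStarRing.norm_one.le
      have : ‖(t : ℂ) ^ 2‖ = t ^ 2 := by simp
      rw [this]
      exact mul_le_of_le_one_right (sq_nonneg t) h1'
    have h3 : ‖φ (b + ((t : ℂ) * Complex.I) • 1)‖ ^ 2 ≤ ‖b‖ ^ 2 + t ^ 2 :=
      (pow_le_pow_left₀ (norm_nonneg _) hn 2).trans h2
    rw [map_add, map_smul, h1, Complex.sq_norm, Complex.normSq_apply] at h3
    simp at h3
    nlinarith [sq_nonneg (φ b).re, sq_nonneg (φ b).im]
  by_contra hne
  have := key ((‖b‖ ^ 2 + 1) / (2 * (φ b).im))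
  rw [mul_div_cancel₀ _ (mul_ne_zero two_ne_zero hne)] at this
  linarith

/-- Contractive unital functionals are states. -/
theorem isState_of_contractive {φ : A →ₗ[ℂ] ℂ} (h1 : φ 1 = 1) (hφ : ∀ a, ‖φ a‖ ≤ ‖a‖) :
    IsState φ := by
  refine ⟨h1, fun a => ?_⟩
  let _ := CStarAlgebra.spectralOrder A
  let _ := CStarAlgebra.spectralOrderedRing A
  set b := star a * a with hb
  have hsa : IsSelfAdjoint b := IsSelfAdjoint.star_mul_self a
  -- From `0 ≤ ‖b‖ - b ≤ ‖b‖`, contractivity yields `‖b‖ - Re φ(b) ≤ ‖b‖`.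
  have hle : algebraMap ℝ A ‖b‖ - b ≤ algebraMap ℝ A ‖b‖ := sub_le_self _ (star_mul_self_nonneg a)
  have hnn : 0 ≤ algebraMap ℝ A ‖b‖ - b := sub_nonneg.2 hsa.le_algebraMap_norm_self
  have hn := (hφ _).trans (CStarAlgebra.norm_le_norm_of_nonneg_of_le hnn hle)
  have h1' : ‖(1 : A)‖ ≤ 1 := by
    rcases subsingleton_or_nontrivial A with h | h
    · simp [Subsingleton.elim (1 : A) 0]
    · exact CStarRing.norm_one.le
  have hn2 : ‖algebraMap ℝ A ‖b‖‖ ≤ ‖b‖ := by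
    rw [Algebra.algebraMap_eq_smul_one]
    refine (norm_smul_le _ _).trans ?_
    rw [norm_norm]
    exact mul_le_of_le_one_right (norm_nonneg b) h1'
  have h4 : φ (algebraMap ℝ A ‖b‖) = (‖b‖ : ℂ) := by
    rw [Algebra.algebraMap_eq_smul_one, ← Complex.coe_smul, map_smul, h1, smul_eq_mul, mul_one]
  have h5 := (Complex.re_le_norm _).trans (hn.trans hn2)
  rw [map_sub, h4, Complex.sub_re, Complex.ofReal_re] at h5
  exact Complex.nonneg_iff.2 ⟨by linarith, (im_apply_eq_zero_of_contractive h1 hφ hsa).symm⟩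

/-- If a state almost concentrates on a self-adjoint contraction `f` with `f u f = 0`, then it
almost vanishes on the contraction `u`. -/
theorem IsState.norm_apply_le_of_mul_mul_eq_zero {φ : A →ₗ[ℂ] ℂ} (hφ : IsState φ) {u f : A}
    (hu : ‖u‖ ≤ 1) (hf : ‖f‖ ≤ 1) (hsa : star f = f) (h0 : f * u * f = 0) :
    ‖φ u‖ ≤ 2 * √(φ (star (1 - f) * (1 - f))).re := by
  set δ := √(φ (star (1 - f) * (1 - f))).re
  have hδ : 0 ≤ δ := Real.sqrt_nonneg _
  have hsq : ∀ a : A, ‖a‖ ≤ 1 → √(φ (star a * a)).re ≤ 1 := fun a ha =>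
    Real.sqrt_le_iff.2 ⟨zero_le_one, (hφ.re_apply_star_mul_self_le a).trans
      (by gcongr)⟩
  -- As `f u f = 0`, `u = (1 - f) u + f u (1 - f)`; each term has a factor `1 - f` on one side, so
  -- Cauchy–Schwarz bounds it by `δ`.
  have hsum : u = star (1 - f) * u + star (star u * f) * (1 - f) := by
    simp only [star_sub, star_one, hsa, star_mul, star_star, sub_mul, mul_sub, one_mul, mul_one, h0]
    abel
  have h1 := hφ.norm_apply_star_mul_le u (1 - f)
  have h2 := hφ.norm_apply_star_mul_le (1 - f) (star u * f)
  have h3 : ‖star u * f‖ ≤ 1 := (norm_mul_le _ _).trans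
    (mul_le_one₀ (by rwa [norm_star]) (norm_nonneg _) hf)
  calc ‖φ u‖ = ‖φ (star (1 - f) * u) + φ (star (star u * f) * (1 - f))‖ := by
        rw [← map_add, ← hsum]
    _ ≤ _ := norm_add_le _ _
    _ ≤ δ * 1 + 1 * δ := add_le_add
        (h1.trans (mul_le_mul_of_nonneg_left (hsq u hu) hδ))
        (h2.trans (mul_le_mul_of_nonneg_right (hsq _ h3) hδ))
    _ = 2 * δ := by ring

end StatesOnCStarAlgebras

/-! ## The reduced C*-algebra -/

section ReducedCStarAlgebra

open scoped ComplexOrder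

variable {Γ : Type*} [Group Γ]

theorem coe_leftRegular (g : Γ) :
    ((leftRegular g : ReducedCStar Γ) : EllTwo Γ →L[ℂ] EllTwo Γ) = leftTranslation g := rfl

theorem coe_innerAction (g : Γ) (a : ReducedCStar Γ) :
    (innerAction g a : EllTwo Γ →L[ℂ] EllTwo Γ) =
      leftTranslation g * a * leftTranslation g⁻¹ := by
  rw [← star_leftTranslation]; rfl

theorem innerAction_leftRegular (g h : Γ) :
    innerAction g (leftRegular h : ReducedCStar Γ) = leftRegular (g * h * g⁻¹) := by
  apply Subtype.ext
  rw [coe_innerAction, coe_leftRegular, coe_leftRegular, leftTranslation_mul, leftTranslation_mul]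

theorem innerAction_mul_apply (g h : Γ) (a : ReducedCStar Γ) :
    innerAction (g * h) a = innerAction g (innerAction h a) := by
  rw [map_mul]; rfl

theorem mem_span_leftTranslation_of_mem_adjoin {a : EllTwo Γ →L[ℂ] EllTwo Γ}
    (ha : a ∈ StarAlgebra.adjoin ℂ (Set.range (leftTranslation (Γ := Γ)))) :
    a ∈ Submodule.span ℂ (Set.range (leftTranslation (Γ := Γ))) := by
  induction ha using StarAlgebra.adjoin_induction with
  | mem x hx => exact Submodule.subset_span hx
  | algebraMap r =>
    rw [Algebra.algebraMap_eq_smul_one, ← leftTranslation_one]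
    exact Submodule.smul_mem _ _ (Submodule.subset_span ⟨1, rfl⟩)
  | add x y _ _ hx hy => exact add_mem hx hy
  | mul x y _ _ hx hy =>
    have := Submodule.mul_mem_mul hx hy
    rw [Submodule.span_mul_span] at this
    refine Submodule.span_mono ?_ this
    rintro _ ⟨_, ⟨g, rfl⟩, _, ⟨h, rfl⟩, rfl⟩
    exact ⟨g * h, leftTranslation_mul g h⟩
  | star x hx0 hx =>
    clear hx0
    induction hx using Submodule.span_induction with
    | mem x hx =>
      obtain ⟨g, rfl⟩ := hx
      exact Submodule.subset_span ⟨g⁻¹, (star_leftTranslation g).symm⟩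
    | zero => simp
    | add x y _ _ hx hy => rw [star_add]; exact add_mem hx hy
    | smul c x _ hx => rw [star_smul]; exact Submodule.smul_mem _ _ hx

/-- Continuous functionals on `C*_λ(Γ)` are determined by their values on the `λ_g`. -/
theorem eq_of_eq_on_leftRegular {φ ψ : ReducedCStar Γ →ₗ[ℂ] ℂ} (hφ : Continuous φ)
    (hψ : Continuous ψ) (h : ∀ g : Γ, φ (leftRegular g : ReducedCStar Γ) = ψ (leftRegular g)) :
    φ = ψ := by
  have hspan : Submodule.span ℂ (Set.range (leftTranslation (Γ := Γ))) ≤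
      (LinearMap.eqLocus φ ψ).map (ReducedCStar Γ).subtype.toLinearMap := by
    rw [Submodule.span_le]
    rintro _ ⟨g, rfl⟩
    exact ⟨(leftRegular g : ReducedCStar Γ), h g, rfl⟩
  ext a
  have ha : a ∈ closure {x | φ x = ψ x} := by
    rw [closure_subtype]
    refine closure_mono ?_ a.2
    intro x hx
    obtain ⟨y, hy, rfl⟩ := hspan (mem_span_leftTranslation_of_mem_adjoin hx)
    exact ⟨y, hy, rfl⟩
  rwa [(isClosed_eq hφ hψ).closure_eq] at ha

theorem IsState.comp_starAlgEquiv {A B : Type*} [CStarAlgebra A] [CStarAlgebra B]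
    {φ : B →ₗ[ℂ] ℂ} (hφ : IsState φ) (e : A ≃⋆ₐ[ℂ] B) :
    IsState (φ ∘ₗ (e : A →⋆ₐ[ℂ] B).toLinearMap) := by
  refine ⟨?_, fun a => ?_⟩
  · change φ (e 1) = 1
    rw [map_one, hφ.1]
  · change 0 ≤ φ (e (star a * a))
    rw [map_mul, map_star]
    exact hφ.2 (e a)

open Classical in
theorem isState_canonicalTrace : IsState (canonicalTrace (Γ := Γ)) := by
  refine ⟨?_, fun a => ?_⟩
  · simpa using canonicalTrace_leftRegular (1 : Γ)
  · have h : canonicalTrace (star a * a) = inner ℂ (lp.single 2 (1 : Γ) (1 : ℂ) : EllTwo Γ)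
        ((star (a : EllTwo Γ →L[ℂ] EllTwo Γ) * a) (lp.single 2 (1 : Γ) (1 : ℂ))) := by
      rw [lp.inner_single_left]
      simp only [RCLike.inner_apply, map_one, mul_one]
      rfl
    rw [h, mul_apply_eq_comp, ContinuousLinearMap.star_eq_adjoint,
      ContinuousLinearMap.adjoint_inner_right, inner_self_eq_norm_sq_to_K]
    norm_cast
    exact Complex.zero_le_real.2 (sq_nonneg _)

theorem canonicalTrace_innerAction (g : Γ) (a : ReducedCStar Γ) :
    canonicalTrace (innerAction g a) = canonicalTrace a := by
  classical
  refine LinearMap.congr_fun (eq_of_eq_on_leftRegular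
    (isState_canonicalTrace.comp_starAlgEquiv (innerAction g)).continuous
    isState_canonicalTrace.continuous fun h => ?_) a
  change canonicalTrace (innerAction g (leftRegular h : ReducedCStar Γ)) = _
  rw [innerAction_leftRegular, canonicalTrace_leftRegular, canonicalTrace_leftRegular]
  simp

theorem hasSum_toReal_pmf {α : Type*} (μ : PMF α) : HasSum (fun a => (μ a).toReal) 1 := by
  have h := ENNReal.hasSum_toReal (f := μ) (by simp [μ.tsum_coe])
  rwa [← ENNReal.tsum_toReal_eq fun a => μ.apply_ne_top a, μ.tsum_coe, ENNReal.toReal_one] at h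

theorem isStationaryFunctional_canonicalTrace (μ : PMF Γ) :
    IsStationaryFunctional μ innerAction (canonicalTrace (Γ := Γ)) := fun a => by
  simp only [canonicalTrace_innerAction]
  simpa using (Complex.hasSum_ofReal.2 (hasSum_toReal_pmf μ)).mul_right (canonicalTrace a)

end ReducedCStarAlgebra

/-! ## Invariant extensions of functionals -/

section InvariantExtension

/-- A functional on a subspace all of whose extensions stay extensions after composing with a
contraction `P` has a `P`-invariant extension of the same norm. -/
theorem exists_invariant_extension {E : Type*} [NormedAddCommGroup E] [NormedSpace ℂ E]
    (P : E →L[ℂ] E) (hP : ∀ x, ‖P x‖ ≤ ‖x‖) (p : Subspace ℂ E) (f : StrongDual ℂ p)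
    (h : ∀ ψ : StrongDual ℂ E, (∀ x : p, ψ x = f x) → ∀ x : p, ψ (P x) = f x) :
    ∃ ψ : StrongDual ℂ E, ‖ψ‖ ≤ ‖f‖ ∧ (∀ x : p, ψ x = f x) ∧ ∀ x, ψ (P x) = ψ x := by
  obtain ⟨ψ₀, hψ₀, hn⟩ := exists_extension_norm_eq p f
  have hPk : ∀ (k : ℕ) (x : E), ‖(P ^ k) x‖ ≤ ‖x‖ := fun k => by
    induction k with
    | zero => simp
    | succ k ih => intro x; rw [pow_succ]; exact (ih (P x)).trans (hP x)
  have hbound : ∀ (k : ℕ) (x : E), ‖ψ₀ ((P ^ k) x)‖ ≤ ‖f‖ * ‖x‖ := fun k x =>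
    (ψ₀.le_opNorm _).trans (by rw [hn]; gcongr; exact hPk k x)
  have hext : ∀ (k : ℕ) (x : p), ψ₀ ((P ^ k) x) = f x := fun k => by
    induction k with
    | zero => simpa using hψ₀
    | succ k ih =>
      intro x
      rw [pow_succ]
      exact h (ψ₀ ∘L P ^ k) ih x
  -- Cesàro means of the `ψ₀ ∘ P ^ k`: all of them extend `f` with norm at most `‖f‖`, and a weak*
  -- limit along an ultrafilter is the required functional.
  let s : ℕ → StrongDual ℂ E := fun n =>
    ((n + 1 : ℝ)⁻¹ : ℂ) • ∑ k ∈ Finset.range (n + 1), ψ₀ ∘L P ^ k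
  have hs : ∀ n x, s n x = ((n + 1 : ℝ)⁻¹ : ℂ) * ∑ k ∈ Finset.range (n + 1), ψ₀ ((P ^ k) x) :=
    fun n x => by simp [s]
  have hc : ∀ n : ℕ, ‖((n + 1 : ℝ)⁻¹ : ℂ)‖ = (n + 1 : ℝ)⁻¹ := fun n => by
    rw [← Complex.ofReal_inv, Complex.norm_real, Real.norm_of_nonneg (by positivity)]
  have hsn : ∀ n, ‖s n‖ ≤ ‖f‖ := fun n => by
    refine ContinuousLinearMap.opNorm_le_bound _ (norm_nonneg f) fun x => ?_
    rw [hs, norm_mul, hc]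
    have : ‖∑ k ∈ Finset.range (n + 1), ψ₀ ((P ^ k) x)‖ ≤ (n + 1 : ℝ) * (‖f‖ * ‖x‖) := by
      refine (norm_sum_le_of_le _ fun k _ => hbound k x).trans ?_
      simp
    rw [inv_mul_le_iff₀ (by positivity)]
    exact this
  obtain ⟨ψ, hψ, hlim⟩ := (WeakDual.isCompact_closedBall (𝕜 := ℂ) (0 : StrongDual ℂ E)
    ‖f‖).ultrafilter_le_nhds ((hyperfilter ℕ).map fun n => StrongDual.toWeakDual (s n))
      (by
        rw [le_principal_iff]
        exact Filter.Eventually.of_forall (p := fun n => StrongDual.toWeakDual (s n) ∈ _)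
          fun n => by simpa using hsn n)
  have hev : ∀ x, Tendsto (fun n => s n x) (hyperfilter ℕ) (𝓝 (ψ x)) := fun x =>
    ((WeakDual.eval_continuous x).tendsto ψ).comp hlim
  refine ⟨WeakDual.toStrongDual ψ, by simpa using hψ, fun x => ?_, fun x => ?_⟩
  · refine tendsto_nhds_unique (hev x) (tendsto_const_nhds.congr fun n => ?_)
    rw [hs, Finset.sum_congr rfl fun k _ => hext k x]
    have : ((n + 1 : ℝ) : ℂ) ≠ 0 := by exact_mod_cast (by positivity : (n + 1 : ℝ) ≠ 0)
    simp only [Finset.sum_const, Finset.card_range, nsmul_eq_mul]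
    push_cast at this ⊢
    field_simp
  · refine tendsto_nhds_unique (hev (P x)) ?_
    -- The sum telescopes to two boundary terms, so the defect of invariance is `O(1/n)`.
    have h0 : Tendsto (fun n => s n (P x) - s n x) (hyperfilter ℕ) (𝓝 0) := by
      refine Tendsto.mono_left ?_ Nat.hyperfilter_le_atTop
      have hb : ∀ n : ℕ, ‖s n (P x) - s n x‖ ≤ 1 / ((n : ℝ) + 1) * (2 * (‖f‖ * ‖x‖)) := fun n => by
        have : s n (P x) - s n x = ((n + 1 : ℝ)⁻¹ : ℂ) * (ψ₀ ((P ^ (n + 1)) x) - ψ₀ ((P ^ 0) x)) := by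
          rw [hs, hs, ← mul_sub, ← Finset.sum_sub_distrib,
            ← Finset.sum_range_sub fun k => ψ₀ ((P ^ k) x)]
          simp only [pow_succ]
          rfl
        rw [this, norm_mul, hc, one_div, two_mul]
        gcongr
        exact (norm_sub_le _ _).trans (add_le_add (hbound _ x) (hbound _ x))
      refine squeeze_zero_norm hb ?_
      simpa using (tendsto_one_div_add_atTop_nhds_zero_nat (𝕜 := ℝ)).mul_const (2 * (‖f‖ * ‖x‖))
    simpa using h0.add (hev x)

variable {Γ : Type*} [Group Γ] {A : Type*} [CStarAlgebra A]

/-- The Markov operator `a ↦ ∑_g μ(g) g⁻¹a` of an action on a C*-algebra. -/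
noncomputable def averageAction (μ : PMF Γ) (α : Γ →* (A ≃⋆ₐ[ℂ] A)) (a : A) : A :=
  ∑' g, ((μ g).toReal : ℂ) • α g⁻¹ a

theorem norm_smul_action_le (μ : PMF Γ) (α : Γ →* (A ≃⋆ₐ[ℂ] A)) (a : A) (g : Γ) :
    ‖((μ g).toReal : ℂ) • α g⁻¹ a‖ ≤ (μ g).toReal * ‖a‖ := by
  rw [norm_smul, Complex.norm_real, Real.norm_of_nonneg ENNReal.toReal_nonneg,
    StarAlgEquiv.norm_map]

theorem hasSum_averageAction (μ : PMF Γ) (α : Γ →* (A ≃⋆ₐ[ℂ] A)) (a : A) :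
    HasSum (fun g => ((μ g).toReal : ℂ) • α g⁻¹ a) (averageAction μ α a) :=
  (Summable.of_norm_bounded ((hasSum_toReal_pmf μ).summable.mul_right ‖a‖)
    (norm_smul_action_le μ α a)).hasSum

theorem norm_averageAction_le (μ : PMF Γ) (α : Γ →* (A ≃⋆ₐ[ℂ] A)) (a : A) :
    ‖averageAction μ α a‖ ≤ ‖a‖ :=
  (tsum_of_norm_bounded ((hasSum_toReal_pmf μ).mul_right ‖a‖)
    (norm_smul_action_le μ α a)).trans_eq (one_mul _)

/-- The Markov operator of an action, as a continuous linear map. -/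
noncomputable def averageActionCLM (μ : PMF Γ) (α : Γ →* (A ≃⋆ₐ[ℂ] A)) : A →L[ℂ] A :=
  LinearMap.mkContinuous
    { toFun := averageAction μ α
      map_add' := fun a b => (hasSum_averageAction μ α (a + b)).unique (by
        simpa using (hasSum_averageAction μ α a).add (hasSum_averageAction μ α b))
      map_smul' := fun c a => (hasSum_averageAction μ α (c • a)).unique (by
        simpa [smul_comm c] using (hasSum_averageAction μ α a).const_smul c) } 1
    fun a => by simpa using norm_averageAction_le μ α a

theorem hasSum_apply_averageActionCLM (μ : PMF Γ) (α : Γ →* (A ≃⋆ₐ[ℂ] A)) (ψ : StrongDual ℂ A)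
    (a : A) :
    HasSum (fun g => ((μ g).toReal : ℂ) * ψ (α g⁻¹ a)) (ψ (averageActionCLM μ α a)) := by
  have h := (hasSum_averageAction μ α a).mapL ψ
  simp only [map_smul, smul_eq_mul] at h
  exact h

/-- A stationary state on an invariant C*-subalgebra extends to a stationary state. -/
theorem IsState.exists_stationary_extension {μ : PMF Γ} {S : StarSubalgebra ℂ A}
    [IsClosed (S : Set A)] {β : Γ →* (S ≃⋆ₐ[ℂ] S)} {α : Γ →* (A ≃⋆ₐ[ℂ] A)}
    (hαβ : ∀ g (a : S), (β g a : A) = α g a) {φ : S →ₗ[ℂ] ℂ}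
    (hφ : IsState φ) (hst : IsStationaryFunctional μ β φ) :
    ∃ ψ : A →ₗ[ℂ] ℂ, IsState ψ ∧ (∀ a : S, ψ a = φ a) ∧ IsStationaryFunctional μ α ψ := by
  let p : Subspace ℂ A := Subalgebra.toSubmodule S.toSubalgebra
  let f₀ : StrongDual ℂ S := hφ.toStrongDual
  have hf₀ : ‖f₀‖ ≤ 1 := LinearMap.mkContinuous_norm_le _ zero_le_one _
  let f : StrongDual ℂ p := f₀
  have hf : ‖f‖ ≤ 1 := hf₀
  have hfφ : ∀ a : S, f a = φ a := fun _ => rfl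
  -- The subalgebra is invariant, so on it `ψ ∘ P` is computed from `φ` alone and equals `φ` by
  -- stationarity, whatever the extension `ψ`.
  obtain ⟨ψ, hn, hext, hinv⟩ := exists_invariant_extension (averageActionCLM μ α)
    (norm_averageAction_le μ α) p f fun ψ hψ x => by
      refine (hasSum_apply_averageActionCLM μ α ψ x).unique ?_
      have h : HasSum (fun g => ((μ g).toReal : ℂ) * f (β g⁻¹ x)) (f x) := hst x
      simp only [← hψ] at h ⊢
      convert h using 4 with g
      exact (hαβ g⁻¹ x).symm
  have hext' : ∀ a : S, ψ a = φ a := hext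
  -- Positivity of the extension comes for free from norm at most one and `ψ 1 = 1`.
  refine ⟨ψ.toLinearMap, isState_of_contractive ?_ fun a => ?_, hext', fun a => ?_⟩
  · exact (hext' 1).trans hφ.1
  · exact (ψ.le_opNorm a).trans (mul_le_of_le_one_left (norm_nonneg a) (hn.trans hf))
  · have := hasSum_apply_averageActionCLM μ α ψ a
    rwa [hinv] at this

end InvariantExtension

/-! ### Conjugation by the regular representation on `B(ℓ²(Γ))` -/

section Conjugation

variable {Γ : Type*} [Group Γ]

/-- The left regular representation, as a homomorphism to the unitary group of `B(ℓ²(Γ))`. -/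
noncomputable def unitaryLeftTranslation : Γ →* unitary (EllTwo Γ →L[ℂ] EllTwo Γ) where
  toFun g := ⟨leftTranslation g, by
    rw [Unitary.mem_iff]
    constructor <;> simp [star_leftTranslation, ← leftTranslation_mul, leftTranslation_one]⟩
  map_one' := Subtype.ext leftTranslation_one
  map_mul' g h := Subtype.ext (leftTranslation_mul g h)

/-- The action of `Γ` on `B(ℓ²(Γ))` by conjugation with the `λ_g`. -/
noncomputable def conjTranslation :
    Γ →* ((EllTwo Γ →L[ℂ] EllTwo Γ) ≃⋆ₐ[ℂ] (EllTwo Γ →L[ℂ] EllTwo Γ)) :=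
  (Unitary.conjStarAlgAut ℂ (EllTwo Γ →L[ℂ] EllTwo Γ)).comp unitaryLeftTranslation

theorem conjTranslation_apply (g : Γ) (a : EllTwo Γ →L[ℂ] EllTwo Γ) :
    conjTranslation g a = leftTranslation g * a * leftTranslation g⁻¹ := by
  rw [← star_leftTranslation]; rfl

theorem coe_innerAction_eq_conjTranslation (g : Γ) (a : ReducedCStar Γ) :
    (innerAction g a : EllTwo Γ →L[ℂ] EllTwo Γ) = conjTranslation g a := by
  rw [coe_innerAction, conjTranslation_apply]

theorem norm_leftTranslation_le (g : Γ) : ‖leftTranslation g‖ ≤ 1 :=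
  LinearIsometry.norm_toContinuousLinearMap_le _

end Conjugation

/-! ## Multiplication operators by continuous functions along an orbit -/

section OrbitMultiplication

variable {Γ : Type*} [Group Γ] {K : Type*} [TopologicalSpace K] [CompactSpace K] [MulAction Γ K]

theorem norm_orbit_mul_le (k : K) (f : C(K, ℝ)) (ξ : EllTwo Γ) (h : Γ) :
    ‖(f (h • k) : ℂ) * ξ h‖ ≤ ‖((‖f‖ : ℂ) • ξ) h‖ := by
  rw [lp.coeFn_smul, Pi.smul_apply, norm_smul, norm_mul, Complex.norm_real, Complex.norm_real,
    norm_norm]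
  gcongr
  exact f.norm_coe_le_norm _

/-- Multiplication by the function `h ↦ f (h k)` on `ℓ²(Γ)`. -/
noncomputable def orbitMul (k : K) (f : C(K, ℝ)) : EllTwo Γ →L[ℂ] EllTwo Γ :=
  LinearMap.mkContinuous
    { toFun := fun ξ => ⟨fun h : Γ => (f (h • k) : ℂ) * ξ h,
        (lp.memℓp ((‖f‖ : ℂ) • ξ)).mono' (norm_orbit_mul_le k f ξ)⟩
      map_add' := fun ξ η => lp.ext (funext fun h => mul_add _ (ξ h) (η h))
      map_smul' := fun c ξ => lp.ext (funext fun h => mul_left_comm _ c (ξ h)) } ‖f‖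
    fun ξ => by
      refine (lp.norm_mono two_ne_zero (y := (‖f‖ : ℂ) • ξ) (norm_orbit_mul_le k f ξ)).trans ?_
      rw [norm_smul, Complex.norm_real, norm_norm]

theorem orbitMul_apply (k : K) (f : C(K, ℝ)) (ξ : EllTwo Γ) (h : Γ) :
    orbitMul k f ξ h = (f (h • k) : ℂ) * ξ h := rfl

theorem norm_orbitMul_le (k : K) (f : C(K, ℝ)) :
    ‖(orbitMul k f : EllTwo Γ →L[ℂ] EllTwo Γ)‖ ≤ ‖f‖ :=
  LinearMap.mkContinuous_norm_le _ (norm_nonneg f) _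

theorem orbitMul_one (k : K) : (orbitMul k 1 : EllTwo Γ →L[ℂ] EllTwo Γ) = 1 := by
  ext ξ h; simp [orbitMul_apply]

theorem orbitMul_add (k : K) (f g : C(K, ℝ)) :
    (orbitMul k (f + g) : EllTwo Γ →L[ℂ] EllTwo Γ) = orbitMul k f + orbitMul k g := by
  ext ξ h; simp [orbitMul_apply, add_mul]

theorem orbitMul_smul (k : K) (c : ℝ) (f : C(K, ℝ)) :
    (orbitMul k (c • f) : EllTwo Γ →L[ℂ] EllTwo Γ) = (c : ℂ) • orbitMul k f := by
  ext ξ h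
  rw [smul_apply, lp.coeFn_smul, Pi.smul_apply, orbitMul_apply, orbitMul_apply]
  simp [mul_assoc]

theorem orbitMul_mul (k : K) (f g : C(K, ℝ)) :
    (orbitMul k (f * g) : EllTwo Γ →L[ℂ] EllTwo Γ) = orbitMul k f * orbitMul k g := by
  ext ξ h; simp [orbitMul_apply, mul_assoc]

theorem star_orbitMul (k : K) (f : C(K, ℝ)) :
    star (orbitMul k f : EllTwo Γ →L[ℂ] EllTwo Γ) = orbitMul k f := by
  rw [ContinuousLinearMap.star_eq_adjoint, eq_comm, ContinuousLinearMap.eq_adjoint_iff]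
  intro ξ η
  rw [lp.inner_eq_tsum, lp.inner_eq_tsum]
  refine tsum_congr fun h => ?_
  simp only [orbitMul_apply, RCLike.inner_apply, map_mul, Complex.conj_ofReal]
  ring

variable [ContinuousConstSMul Γ K]

/-- Covariance: it makes `orbitMul k` an equivariant homomorphism, so that stationarity passes from
states on `B(ℓ²(Γ))` to measures on `K`. -/
theorem conjTranslation_orbitMul (k : K) (g : Γ) (f : C(K, ℝ)) :
    conjTranslation g (orbitMul k f) =
      orbitMul k (f.comp ⟨fun x => g⁻¹ • x, continuous_const_smul g⁻¹⟩) := by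
  ext ξ h
  simp [conjTranslation_apply, orbitMul_apply, mul_smul]

end OrbitMultiplication

/-! ### The stationary measure induced by a state along an orbit -/

section OrbitState

open scoped ComplexOrder

variable {Γ : Type*} [Group Γ] {K : Type*} [TopologicalSpace K] [CompactSpace K] [MulAction Γ K]

theorem IsState.re_apply_orbitMul_nonneg {ψ : (EllTwo Γ →L[ℂ] EllTwo Γ) →ₗ[ℂ] ℂ}
    (hψ : IsState ψ) (k : K) {f : C(K, ℝ)} (hf : ∀ x, 0 ≤ f x) : 0 ≤ (ψ (orbitMul k f)).re := by
  have hs : f = (⟨fun x => √(f x), by fun_prop⟩ : C(K, ℝ)) * ⟨fun x => √(f x), by fun_prop⟩ := by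
    ext x
    exact (Real.mul_self_sqrt (hf x)).symm
  rw [hs, orbitMul_mul]
  nth_rewrite 1 [← star_orbitMul]
  exact (Complex.nonneg_iff.1 (hψ.2 _)).1

variable [T2Space K] [MeasurableSpace K] [BorelSpace K]

/-- The positive functional on `C(K)` induced by a state on `B(ℓ²(Γ))` and the orbit of `k`. -/
noncomputable def IsState.orbitFunctional {ψ : (EllTwo Γ →L[ℂ] EllTwo Γ) →ₗ[ℂ] ℂ}
    (hψ : IsState ψ) (k : K) : CompactlySupportedContinuousMap K ℝ →ₚ[ℝ] ℝ :=
  PositiveLinearMap.mk₀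
    { toFun := fun f => (ψ (orbitMul k f.toContinuousMap)).re
      map_add' := fun f g => by
        rw [← Complex.add_re, ← map_add, ← orbitMul_add]; rfl
      map_smul' := fun c f => by
        have : (c • f).toContinuousMap = c • f.toContinuousMap := rfl
        rw [this, orbitMul_smul, map_smul]; simp }
    fun f hf => hψ.re_apply_orbitMul_nonneg k fun x => hf x

/-- The measure on `K` induced by a state on `B(ℓ²(Γ))` and the orbit of `k`. -/
noncomputable def IsState.orbitMeasure {ψ : (EllTwo Γ →L[ℂ] EllTwo Γ) →ₗ[ℂ] ℂ}
    (hψ : IsState ψ) (k : K) : Measure K :=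
  RealRMK.rieszMeasure (hψ.orbitFunctional k)

theorem IsState.integral_orbitMeasure {ψ : (EllTwo Γ →L[ℂ] EllTwo Γ) →ₗ[ℂ] ℂ}
    (hψ : IsState ψ) (k : K) (f : C(K, ℝ)) :
    ∫ x, f x ∂hψ.orbitMeasure k = (ψ (orbitMul k f)).re :=
  RealRMK.integral_rieszMeasure (hψ.orbitFunctional k)
    (CompactlySupportedContinuousMap.continuousMapEquiv f)

instance {ψ : (EllTwo Γ →L[ℂ] EllTwo Γ) →ₗ[ℂ] ℂ} (hψ : IsState ψ) (k : K) :
    (hψ.orbitMeasure k).Regular :=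
  RealRMK.regular_rieszMeasure _

instance {ψ : (EllTwo Γ →L[ℂ] EllTwo Γ) →ₗ[ℂ] ℂ} (hψ : IsState ψ) (k : K) :
    IsProbabilityMeasure (hψ.orbitMeasure k) := by
  have : IsFiniteMeasure (hψ.orbitMeasure k) :=
    inferInstanceAs (IsFiniteMeasure (RealRMK.rieszMeasure (hψ.orbitFunctional k)))
  have h := hψ.integral_orbitMeasure k 1
  simp only [ContinuousMap.one_apply, integral_const, smul_eq_mul, mul_one, orbitMul_one, hψ.1,
    Complex.one_re] at h
  exact ⟨by rw [← ofReal_measureReal, h, ENNReal.ofReal_one]⟩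

theorem isProbabilityMeasure_sum_smul_map (μ : PMF Γ) {X : Type*} [MeasurableSpace X]
    [MulAction Γ X] [MeasurableConstSMul Γ X] (η : Measure X) [IsProbabilityMeasure η] :
    IsProbabilityMeasure (Measure.sum fun g : Γ => μ g • η.map fun x => g • x) := by
  refine ⟨?_⟩
  rw [Measure.sum_apply _ MeasurableSet.univ]
  simp [Measure.map_apply (measurable_const_smul _) MeasurableSet.univ, μ.tsum_coe]

variable [ContinuousConstSMul Γ K]

theorem IsState.isStationaryMeasure_orbitMeasure {μ : PMF Γ}
    {ψ : (EllTwo Γ →L[ℂ] EllTwo Γ) →ₗ[ℂ] ℂ} (hψ : IsState ψ)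
    (hst : IsStationaryFunctional μ conjTranslation ψ) (k : K) :
    IsStationaryMeasure μ (hψ.orbitMeasure k) := by
  set η := hψ.orbitMeasure k
  have hprob := isProbabilityMeasure_sum_smul_map μ η
  -- Integrals of continuous functions determine only regular measures, so regularity of the
  -- averaged measure is needed too.
  have hreg : ∀ g : Γ, (η.map fun x => g • x).InnerRegular := fun g =>
    Measure.InnerRegular.map_of_continuous (continuous_const_smul g)
  have : (Measure.sum fun g : Γ => μ g • η.map fun x => g • x).Regular := inferInstance
  refine Measure.ext_of_integral_eq_on_compactlySupported fun f => ?_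
  have hint : ∀ (ρ : Measure K) [IsFiniteMeasure ρ], Integrable f ρ := fun ρ _ =>
    f.continuous.integrable_of_hasCompactSupport f.hasCompactSupport
  refine (hasSum_integral_measure (hint _)).unique ?_
  have h := Complex.hasSum_re (hst (orbitMul k f.toContinuousMap))
  have hη : ∫ x, f x ∂η = (ψ (orbitMul k f.toContinuousMap)).re :=
    hψ.integral_orbitMeasure k f.toContinuousMap
  rw [hη]
  refine HasSum.congr_fun (f := fun g => (((μ g).toReal : ℂ) * ψ (conjTranslation g⁻¹
    (orbitMul k f.toContinuousMap))).re) h fun g => ?_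
  rw [integral_smul_measure, integral_map (continuous_const_smul g).aemeasurable
    (show Continuous f from f.continuous).aestronglyMeasurable, conjTranslation_orbitMul, Complex.re_ofReal_mul,
    ← hψ.integral_orbitMeasure, inv_inv]
  rfl

/-- The orbit functional of a stationary state on a uniquely stationary space. -/
theorem IsUniqueStationaryMeasure.integral_eq {μ : PMF Γ} {η : Measure K}
    (hη : IsUniqueStationaryMeasure μ η) {ψ : (EllTwo Γ →L[ℂ] EllTwo Γ) →ₗ[ℂ] ℂ}
    (hψ : IsState ψ) (hst : IsStationaryFunctional μ conjTranslation ψ) (k : K) (f : C(K, ℝ)) :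
    (ψ (orbitMul k f)).re = ∫ x, f x ∂η := by
  rw [← hη.2 (hψ.orbitMeasure k) inferInstance inferInstance
    (hψ.isStationaryMeasure_orbitMeasure hst k), hψ.integral_orbitMeasure]

end OrbitState

/-! ## Concentration of translates of a stationary state -/

section Concentration

variable {Γ : Type*} [Group Γ] {K : Type*} [TopologicalSpace K] [CompactSpace K] [T2Space K]
  [MulAction Γ K] [ContinuousConstSMul Γ K]

/-- A function that is `1` on a compact set displaced by `g`, and whose support is essentially
displaced by `g`. -/
theorem exists_continuous_mul_smul_eq_zero {g : Γ} {C : Set K} (hC : IsCompact C)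
    (hg : ∀ x ∈ C, g • x ∉ C) :
    ∃ f : C(K, ℝ), (∀ x, 0 ≤ f x) ∧ (∀ x, f x ≤ 1) ∧ (∀ x ∈ C, f x = 1) ∧
      ∀ x, f x * f (g • x) = 0 := by
  have hc1 : IsClosed ((fun x => g • x) ⁻¹' C ∪ (fun x => g⁻¹ • x) ⁻¹' C) :=
    (hC.isClosed.preimage (continuous_const_smul g)).union
      (hC.isClosed.preimage (continuous_const_smul g⁻¹))
  obtain ⟨u, hu0, hu1, hu⟩ := exists_continuous_zero_one_of_isClosed hc1 hC.isClosed (by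
    rw [Set.disjoint_right]
    rintro x hx (h | h)
    · exact hg x hx h
    · exact hg _ h (by simpa using hx))
  have hcont : ∀ h : Γ, Continuous fun x : K => h • x := continuous_const_smul
  -- Positivity of this function at `x` forces `u x > u (g • x)`, and positivity at `g • x` forces
  -- the reverse, so the product vanishes. On `C` it equals `1`, since `u` vanishes on `g C` and
  -- `g⁻¹ C`.
  have hv : Continuous fun x => max 0 (u x - max (u (g • x)) (u (g⁻¹ • x))) :=
    continuous_const.max (u.continuous.sub
      ((u.continuous.comp (hcont g)).max (u.continuous.comp (hcont g⁻¹))))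
  refine ⟨⟨_, hv⟩, fun x => le_max_left _ _, fun x => ?_, fun x hx => ?_, fun x => ?_⟩
  · refine max_le zero_le_one ?_
    have h1 := (hu x).2
    have h2 := (hu (g • x)).1.trans (le_max_left _ (u (g⁻¹ • x)))
    linarith
  · have h1 : u (g • x) = 0 := hu0 (Or.inr (by simpa using hx))
    have h2 : u (g⁻¹ • x) = 0 := hu0 (Or.inl (by simpa using hx))
    have h3 : u x = 1 := hu1 hx
    simp [h1, h2, h3]
  · simp only [ContinuousMap.coe_mk, inv_smul_smul, mul_eq_zero]
    rcases le_total (u x) (u (g • x)) with h | h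
    · left
      exact max_eq_left (sub_nonpos.2 (h.trans (le_max_left _ _)))
    · right
      exact max_eq_left (sub_nonpos.2 (h.trans (le_max_right _ _)))

variable [MeasurableSpace K] [BorelSpace K]

/-- A set obtained through a measurable isomorphism is displaced only up to a null set. Removing
that null set and passing to a compact subset gives genuine displacement at arbitrarily small cost
in measure. -/
theorem exists_continuous_of_measure_inter_eq_zero (ρ : Measure K) [IsProbabilityMeasure ρ]
    [ρ.InnerRegular] {g : Γ} {W : Set K} (hW : MeasurableSet W)
    (hdisp : ρ {x | x ∈ W ∧ g • x ∈ W} = 0) {r : ℝ} (hρ : ENNReal.ofReal r < ρ W) :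
    ∃ f : C(K, ℝ), (∀ x, 0 ≤ f x) ∧ (∀ x, f x ≤ 1) ∧ (∀ x, f x * f (g • x) = 0) ∧
      r ≤ ∫ x, f x ∂ρ := by
  have hmeas : MeasurableSet {x | x ∈ W ∧ g • x ∈ W} :=
    hW.inter (hW.preimage (measurable_const_smul g))
  have hρ' : ENNReal.ofReal r < ρ (W \ {x | x ∈ W ∧ g • x ∈ W}) := by
    rwa [measure_sdiff_null hdisp]
  obtain ⟨C, hCW, hC, hrC⟩ := (hW.diff hmeas).exists_lt_isCompact hρ'
  obtain ⟨f, h0, h1, hfC, hfg⟩ := exists_continuous_mul_smul_eq_zero (g := g) hC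
    fun x hx hgx => (hCW hx).2 ⟨(hCW hx).1, (hCW hgx).1⟩
  refine ⟨f, h0, h1, hfg, ?_⟩
  have hint : Integrable f ρ :=
    f.continuous.integrable_of_hasCompactSupport (HasCompactSupport.of_compactSpace f)
  calc r ≤ ρ.real C := (ENNReal.ofReal_le_iff_le_toReal (measure_ne_top ρ C)).1 hrC.le
    _ = ∫ x, C.indicator (fun _ => (1 : ℝ)) x ∂ρ := by
        rw [integral_indicator_const _ hC.measurableSet, smul_eq_mul, mul_one]
    _ ≤ ∫ x, f x ∂ρ := by
        refine integral_mono ((integrable_const _).indicator hC.measurableSet) hint fun x => ?_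
        by_cases hx : x ∈ C
        · simp [hx, hfC x hx]
        · simpa [hx] using h0 x

/-- The state `a ↦ ψ(h⁻¹ · a)` integrates functions on `K` against the translate of `η` by `h`, and
`f λ_g f = f · (f ∘ g⁻¹) · λ_g = 0`, so the estimate for states concentrated on `f` applies. -/
theorem IsUniqueStationaryMeasure.norm_apply_conjTranslation_le {μ : PMF Γ} {η : Measure K}
    (hη : IsUniqueStationaryMeasure μ η) {ψ : (EllTwo Γ →L[ℂ] EllTwo Γ) →ₗ[ℂ] ℂ}
    (hψ : IsState ψ) (hst : IsStationaryFunctional μ conjTranslation ψ) {g h : Γ} {f : C(K, ℝ)}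
    (h0 : ∀ x, 0 ≤ f x) (h1 : ∀ x, f x ≤ 1) (hfg : ∀ x, f x * f (g • x) = 0) :
    ‖ψ (conjTranslation h⁻¹ (leftTranslation g))‖ ≤ 2 * √(1 - ∫ x, f (h • x) ∂η) := by
  have hprob := hη.1.1
  obtain ⟨k⟩ : Nonempty K := nonempty_of_isProbabilityMeasure η
  have hχ := hψ.comp_starAlgEquiv (conjTranslation (h⁻¹ : Γ))
  have hf : ‖(orbitMul k f : EllTwo Γ →L[ℂ] EllTwo Γ)‖ ≤ 1 := by
    refine (norm_orbitMul_le k f).trans ((ContinuousMap.norm_le f zero_le_one).2 fun x => ?_)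
    rw [Real.norm_of_nonneg (h0 x)]
    exact h1 x
  have hmul : orbitMul k f * leftTranslation g * orbitMul k f = 0 := by
    have hz : f * f.comp ⟨fun x => g⁻¹ • x, continuous_const_smul g⁻¹⟩ = 0 := by
      ext x
      have := hfg (g⁻¹ • x)
      rw [smul_inv_smul, mul_comm] at this
      exact this
    have hc := conjTranslation_orbitMul k g f
    calc orbitMul k f * leftTranslation g * orbitMul k f
        = orbitMul k f * conjTranslation g (orbitMul k f) * leftTranslation g := by
          rw [conjTranslation_apply]
          simp only [mul_assoc, ← leftTranslation_mul, inv_mul_cancel, leftTranslation_one,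
            mul_one]
      _ = 0 := by
          rw [hc, ← orbitMul_mul, hz]
          ext ξ x
          simp [orbitMul_apply]
  refine (hχ.norm_apply_le_of_mul_mul_eq_zero (norm_leftTranslation_le g) hf (star_orbitMul k f)
    hmul).trans ?_
  gcongr
  have hsub : (1 - orbitMul k f : EllTwo Γ →L[ℂ] EllTwo Γ) = orbitMul k (1 - f) := by
    ext ξ x
    simp [orbitMul_apply, sub_mul]
  have hint : ∀ u : C(K, ℝ), Integrable u η := fun u =>
    u.continuous.integrable_of_hasCompactSupport (HasCompactSupport.of_compactSpace u)
  rw [hsub, star_orbitMul, ← orbitMul_mul]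
  change (ψ (conjTranslation h⁻¹ _)).re ≤ _
  rw [conjTranslation_orbitMul, hη.integral_eq hψ hst]
  have hfh : Integrable (fun x => f (h • x)) η :=
    hint (f.comp ⟨fun x => h • x, continuous_const_smul h⟩)
  have : 1 - ∫ x, f (h • x) ∂η = ∫ x, (1 - f (h • x)) ∂η := by
    rw [integral_sub (integrable_const 1) hfh]; simp
  rw [this]
  -- Pointwise `(1 - f)² ≤ 1 - f`, because `0 ≤ f ≤ 1`.
  refine integral_mono (hint _) ((integrable_const 1).sub hfh) fun x => ?_
  have e0 := h0 (h • x)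
  have e1 := h1 (h • x)
  simp only [ContinuousMap.comp_apply, ContinuousMap.coe_mk, inv_inv, ContinuousMap.mul_apply,
    ContinuousMap.sub_apply, ContinuousMap.one_apply]
  nlinarith

theorem IsUniqueStationaryMeasure.norm_apply_conjTranslation_le_of_measure {μ : PMF Γ}
    {η : Measure K} (hη : IsUniqueStationaryMeasure μ η)
    {ψ : (EllTwo Γ →L[ℂ] EllTwo Γ) →ₗ[ℂ] ℂ}
    (hψ : IsState ψ) (hst : IsStationaryFunctional μ conjTranslation ψ) {g h : Γ} {W : Set K}
    (hW : MeasurableSet W) (hdisp : η {x | h • x ∈ W ∧ (g * h) • x ∈ W} = 0)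
    {r : ℝ} (hηW : ENNReal.ofReal r < η {x | h • x ∈ W}) :
    ‖ψ (conjTranslation h⁻¹ (leftTranslation g))‖ ≤ 2 * √(1 - r) := by
  have hprob := hη.1.1
  have hreg := hη.1.2.1
  have hm : Measurable fun x : K => h • x := measurable_const_smul h
  have := Measure.isProbabilityMeasure_map (μ := η) hm.aemeasurable
  have : (η.map fun x => h • x).InnerRegular :=
    Measure.InnerRegular.map_of_continuous (continuous_const_smul h)
  obtain ⟨f, h0, h1, hfg, hr'⟩ := exists_continuous_of_measure_inter_eq_zero
    (η.map fun x => h • x) (g := g) hW (by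
      have hWg : MeasurableSet {x | x ∈ W ∧ g • x ∈ W} :=
        hW.inter (hW.preimage (measurable_const_smul g))
      rw [Measure.map_apply hm hWg]
      simpa only [mul_smul, Set.preimage_ofPred_eq] using hdisp) (by rwa [Measure.map_apply hm hW])
  rw [integral_map hm.aemeasurable f.continuous.aestronglyMeasurable] at hr'
  refine (hη.norm_apply_conjTranslation_le hψ hst h0 h1 hfg).trans ?_
  gcongr

end Concentration

/-! ## Transport of sets along isomorphisms of measured actions -/

section Transport

variable {Γ : Type*} [Group Γ] {X Y : Type*} [MeasurableSpace X] [MulAction Γ X]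
  [MeasurableSpace Y] [MulAction Γ Y] {ν : Measure X} {η : Measure Y}

theorem IsNonsingularAction.ae_smul [MeasurableConstSMul Γ X] (hν : IsNonsingularAction Γ ν)
    (g : Γ) {p : X → Prop} (hp : ∀ᵐ x ∂ν, p x) : ∀ᵐ x ∂ν, p (g • x) :=
  ae_of_ae_map (measurable_const_smul g).aemeasurable ((hν g).1.ae_le hp)

/-- Measurable sets correspond to each other, equivariantly, under an isomorphism. -/
theorem IsoMeasuredAction.exists_transport [MeasurableConstSMul Γ X]
    (hν : IsNonsingularAction Γ ν) (hiso : IsoMeasuredAction Γ ν η) :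
    ∃ φ : X → Y, Measurable φ ∧ ν.map φ = η ∧ (∀ g : Γ, ∀ᵐ x ∂ν, φ (g • x) = g • φ x) ∧
      (∀ g : Γ, ∀ᵐ x ∂ν, g • φ x = φ x → g • x = x) ∧
      ∀ V, MeasurableSet V → ∃ W, MeasurableSet W ∧ ∀ g : Γ, ∀ᵐ x ∂ν, g • φ x ∈ W ↔ g • x ∈ V := by
  obtain ⟨φ, ψ, hφ, hψ, hmap, hψφ, -, heq⟩ := hiso
  refine ⟨φ, hφ, hmap, heq, fun g => ?_, fun V hV => ⟨ψ ⁻¹' V, hψ hV, fun g => ?_⟩⟩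
  -- Non-singularity lets the almost everywhere identity `ψ (φ x) = x` be used at `g • x` as well.
  · filter_upwards [heq g, hψφ, hν.ae_smul g hψφ] with x h1 h2 h3 h4
    rw [← h3, h1, h4, h2]
  · filter_upwards [heq g, hν.ae_smul g hψφ] with x h1 h2
    rw [Set.mem_preimage, ← h1, h2]

end Transport

/-! ## Harmonic functions along the random walk -/

section RandomWalk

open ProbabilityTheory

variable {Γ : Type*} [Group Γ]

/-- The position at time `n` involves only the increments before `s n`, hence is independent of it.
-/
theorem exists_walkPosition_eq (n : ℕ) :
    ∃ F : (Finset.range n → Γ) → Γ, ∀ s : ℕ → Γ, walkPosition s n = F fun i => s i := by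
  induction n with
  | zero => exact ⟨fun _ => 1, fun s => rfl⟩
  | succ n ih =>
    obtain ⟨F, hF⟩ := ih
    exact ⟨fun t => F (fun i => t ⟨i, Finset.mem_range.2 ((Finset.mem_range.1 i.2).trans
      n.lt_succ_self)⟩) * t ⟨n, Finset.self_mem_range_succ n⟩, fun s => by
        rw [walkPosition, hF]⟩

variable [MeasurableSpace Γ] [Countable Γ] [DiscreteMeasurableSpace Γ]

theorem indepFun_walkPosition (μ : PMF Γ) (n : ℕ) :
    IndepFun (fun s : ℕ → Γ => walkPosition s n) (fun s => s n)
      (Measure.infinitePi fun _ : ℕ => μ.toMeasure) := by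
  obtain ⟨F, hF⟩ := exists_walkPosition_eq (Γ := Γ) n
  have h := (iIndepFun_infinitePi (P := fun _ : ℕ => μ.toMeasure) (X := fun _ x => x)
    (fun _ => measurable_id)).indepFun_finset (Finset.range n) {n} (by simp)
    fun i => measurable_pi_apply i
  have h2 := h.comp (φ := F) (ψ := fun t => t ⟨n, Finset.mem_singleton_self n⟩)
    (measurable_of_countable F) (measurable_of_countable _)
  rw [show (fun s : ℕ → Γ => walkPosition s n) = F ∘ fun s i => s i from funext hF]
  exact h2

theorem pathMeasure_map_eval_zero (μ : PMF Γ) :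
    (pathMeasure μ).map (fun ω => ω 0) = Measure.dirac 1 := by
  rw [pathMeasure, Measure.map_map (measurable_pi_apply 0) measurable_walkPosition]
  have : (fun ω : ℕ → Γ => ω 0) ∘ walkPosition = fun _ => 1 := rfl
  rw [this, Measure.map_const, measure_univ, one_smul]

theorem pathMeasure_map_eval_succ (μ : PMF Γ) (n : ℕ) :
    (pathMeasure μ).map (fun ω => ω (n + 1)) =
      (((pathMeasure μ).map fun ω => ω n).prod μ.toMeasure).map fun p => p.1 * p.2 := by
  have hw : Measurable fun s : ℕ → Γ => walkPosition s n :=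
    (measurable_pi_apply n).comp measurable_walkPosition
  have h := (indepFun_iff_map_prod_eq_prod_map_map hw.aemeasurable
    (measurable_pi_apply n).aemeasurable).1 (indepFun_walkPosition μ n)
  rw [Measure.infinitePi_map_eval] at h
  rw [pathMeasure, Measure.map_map (measurable_pi_apply _) measurable_walkPosition,
    Measure.map_map (measurable_pi_apply _) measurable_walkPosition]
  change _ = Measure.map _ ((Measure.map (fun s : ℕ → Γ => walkPosition s n) _).prod _)
  rw [← h, Measure.map_map (measurable_of_countable _)
    (hw.prodMk (measurable_pi_apply n))]
  rfl

/-- Increments multiply on the right, so one step of the walk averages `Q (h * g)` over `g`, which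
is harmonicity; the mean is therefore constant in `n`. -/
theorem lintegral_pathMeasure_of_harmonic (μ : PMF Γ) {Q : Γ → ℝ≥0∞}
    (hQ : ∀ h, ∑' g, μ g * Q (h * g) = Q h) (n : ℕ) :
    ∫⁻ ω, Q (ω n) ∂(pathMeasure μ) = Q 1 := by
  have hQm : Measurable Q := measurable_of_countable Q
  rw [← lintegral_map hQm (measurable_pi_apply n)]
  induction n with
  | zero => rw [pathMeasure_map_eval_zero, lintegral_dirac]
  | succ n ih =>
    have := Measure.isProbabilityMeasure_map (μ := pathMeasure μ)
      (measurable_pi_apply n).aemeasurable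
    rw [pathMeasure_map_eval_succ, lintegral_map hQm (measurable_of_countable _),
      lintegral_prod _ (measurable_of_countable _).aemeasurable, ← ih]
    refine lintegral_congr fun h => ?_
    rw [lintegral_countable', ← hQ h]
    refine tsum_congr fun g => ?_
    rw [μ.toMeasure_apply_singleton g (measurableSet_singleton g), mul_comm]

theorem integral_pathMeasure_of_harmonic (μ : PMF Γ) {Q : Γ → ℂ} {C : ℝ} (hC : ∀ h, ‖Q h‖ ≤ C)
    (hQ : ∀ h, HasSum (fun g => ((μ g).toReal : ℂ) * Q (h * g)) (Q h)) (n : ℕ) :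
    ∫ ω, Q (ω n) ∂(pathMeasure μ) = Q 1 := by
  have hQm : ∀ ρ : Measure Γ, AEStronglyMeasurable Q ρ := fun ρ =>
    (measurable_of_countable Q).aestronglyMeasurable
  rw [← integral_map (measurable_pi_apply n).aemeasurable (hQm _)]
  induction n with
  | zero => rw [pathMeasure_map_eval_zero, integral_dirac]
  | succ n ih =>
    have := Measure.isProbabilityMeasure_map (μ := pathMeasure μ)
      (measurable_pi_apply n).aemeasurable
    have hm : Measurable fun p : Γ × Γ => Q (p.1 * p.2) := measurable_of_countable _
    rw [pathMeasure_map_eval_succ, integral_map (measurable_of_countable _).aemeasurable (hQm _),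
      integral_prod _ (Integrable.of_bound hm.aestronglyMeasurable C (ae_of_all _ fun p => hC _)),
      ← ih]
    refine integral_congr_ae (ae_of_all _ fun h => ?_)
    dsimp only
    have hm' : Measurable fun g : Γ => Q (h * g) := measurable_of_countable _
    rw [PMF.integral_eq_tsum _ _ (Integrable.of_bound hm'.aestronglyMeasurable C
      (ae_of_all _ fun p => hC _)), ← (hQ h).tsum_eq]
    simp

end RandomWalk

/-! ## Limits of the walk on an essentially free boundary -/

section BoundaryLimits

variable {Γ : Type*} [Group Γ] {M : Type*} [MeasurableSpace M] [MulAction Γ M]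
  [MeasurableConstSMul Γ M]

theorem IsStationaryMeasure.tsum_lintegral {μ : PMF Γ} {η : Measure M}
    (hη : IsStationaryMeasure μ η) {F : M → ℝ≥0∞} (hF : Measurable F) (h : Γ) :
    ∑' g, μ g * ∫⁻ x, F ((h * g) • x) ∂η = ∫⁻ x, F (h • x) ∂η := by
  conv_rhs => rw [← hη]
  rw [lintegral_sum_measure]
  refine tsum_congr fun g => ?_
  have hFh : Measurable fun x => F (h • x) := hF.comp (measurable_const_smul h)
  rw [lintegral_smul_measure, lintegral_map hFh (measurable_const_smul g), smul_eq_mul]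
  simp only [mul_smul]

variable [Countable Γ] [MeasurableSpace Γ] [DiscreteMeasurableSpace Γ]

theorem IsStationaryMeasure.lintegral_lintegral_pathMeasure {μ : PMF Γ} {η : Measure M}
    (hη : IsStationaryMeasure μ η) {F : M → ℝ≥0∞} (hF : Measurable F) (n : ℕ) :
    ∫⁻ ω, ∫⁻ x, F (ω n • x) ∂η ∂(pathMeasure μ) = ∫⁻ x, F x ∂η := by
  simpa using lintegral_pathMeasure_of_harmonic μ
    (Q := fun h => ∫⁻ x, F (h • x) ∂η) (hη.tsum_lintegral hF) n

/-- If the integrals of the `F k` tend to zero, then for almost every path the lower limits of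
the integrals of some `F k` along the path are less than one. -/
theorem IsStationaryMeasure.ae_exists_liminf_lt_one {μ : PMF Γ} {η : Measure M}
    (hη : IsStationaryMeasure μ η) {F : ℕ → M → ℝ≥0∞} (hF : ∀ k, Measurable (F k))
    (hlim : Tendsto (fun k => ∫⁻ x, F k x ∂η) atTop (𝓝 0)) :
    ∀ᵐ ω ∂(pathMeasure μ), ∃ k, liminf (fun n => ∫⁻ x, F k (ω n • x) ∂η) atTop < 1 := by
  have hm : ∀ k n, Measurable fun ω : ℕ → Γ => ∫⁻ x, F k (ω n • x) ∂η := fun k n =>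
    (measurable_of_countable fun h : Γ => ∫⁻ x, F k (h • x) ∂η).comp (measurable_pi_apply n)
  -- Markov's inequality, then Fatou: the mean of each integral along the path is `∫ F k`,
  -- independent of `n`.
  have hle : ∀ k, pathMeasure μ {ω | 1 ≤ liminf (fun n => ∫⁻ x, F k (ω n • x) ∂η) atTop} ≤
      ∫⁻ x, F k x ∂η := fun k => by
    have h1 := mul_meas_ge_le_lintegral (μ := pathMeasure μ) (Measurable.liminf (hm k)) 1
    rw [one_mul] at h1
    refine h1.trans ((lintegral_liminf_le (hm k)).trans ?_)
    simp only [hη.lintegral_lintegral_pathMeasure (hF k), liminf_const, le_refl]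
  rw [ae_iff]
  refine le_antisymm (ge_of_tendsto' hlim fun k => (measure_mono ?_).trans (hle k)) zero_le
  intro ω hω
  simp only [not_exists, not_lt, Set.mem_ofPred_eq] at hω
  exact hω k

variable [TopologicalSpace M] [CompactSpace M] [TopologicalSpace.MetrizableSpace M] [BorelSpace M]
  [ContinuousConstSMul Γ M]

/-- On an essentially free boundary, almost every path eventually concentrates the stationary
measure on sets displaced by `g`. -/
theorem IsTopologicalModelBoundary.ae_eventually_exists_displaced {μ : PMF Γ} {η : Measure M}
    [IsProbabilityMeasure η] (hη : IsTopologicalModelBoundary μ η) {g : Γ}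
    (hfree : η {x | g • x = x} = 0) :
    ∀ᵐ ω ∂(pathMeasure μ), ∀ r < (1 : ℝ), ∀ᶠ n in atTop, ∃ U : Set M, MeasurableSet U ∧
      (∀ x ∈ U, g • x ∉ U) ∧ ENNReal.ofReal r < η {x | ω n • x ∈ U} := by
  let _ := TopologicalSpace.metrizableSpaceMetric M
  have hcont : ∀ h : Γ, Continuous fun x : M => h • x := continuous_const_smul
  -- Bump functions decreasing to the indicator of the fixed point set of `g`, whose integrals tend
  -- to zero by essential freeness.
  let θ : ℕ → C(M, ℝ) := fun k =>
    ⟨fun x => max 0 (1 - k * dist (g • x) x), continuous_const.max (continuous_const.sub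
      (continuous_const.mul ((hcont g).dist continuous_id)))⟩
  have hθ0 : ∀ k x, 0 ≤ θ k x := fun k x => le_max_left _ _
  have hθ1 : ∀ k x, θ k x ≤ 1 := fun k x =>
    max_le zero_le_one (sub_le_self _ (by positivity))
  have hlim : Tendsto (fun k => ∫⁻ x, ENNReal.ofReal (θ k x) ∂η) atTop (𝓝 0) := by
    have h0 : ∫⁻ _, 0 ∂η = 0 := lintegral_zero
    rw [← h0]
    refine tendsto_lintegral_of_dominated_convergence (fun _ => 1)
      (fun k => (θ k).continuous.measurable.ennreal_ofReal)
      (fun k => ae_of_all _ fun x => ENNReal.ofReal_le_one.2 (hθ1 k x)) (by simp) ?_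
    filter_upwards [measure_eq_zero_iff_ae_notMem.1 hfree] with x hx
    have hd : 0 < dist (g • x) x := dist_pos.2 hx
    refine tendsto_const_nhds.congr' ?_
    obtain ⟨N, hN⟩ := exists_nat_gt (1 / dist (g • x) x)
    filter_upwards [eventually_ge_atTop N] with k hk
    have : 1 ≤ k * dist (g • x) x := by
      rw [← div_le_iff₀ hd]
      exact hN.le.trans (by exact_mod_cast hk)
    have hz : θ k x = 0 := max_eq_left (by linarith)
    rw [hz, ENNReal.ofReal_zero]
  filter_upwards [hη.2, hη.1.ae_exists_liminf_lt_one
    (fun k => (θ k).continuous.measurable.ennreal_ofReal) hlim] with ω ⟨x, hx⟩ ⟨k, hk⟩ r hr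
  simp only [integral_dirac] at hx
  have hx' : ∀ f : C(M, ℝ), Tendsto (fun n => ∫ y, f (ω n • y) ∂η) atTop (𝓝 (f x)) := fun f => by
    refine (hx f).congr fun n => ?_
    rw [integral_map (hcont _).aemeasurable f.continuous.aestronglyMeasurable]
  have hint : ∀ (f : C(M, ℝ)) (h : Γ), Integrable (fun y => f (h • y)) η := fun f h =>
    (f.continuous.comp (hcont h)).integrable_of_hasCompactSupport
      (HasCompactSupport.of_compactSpace _)
  -- At a fixed point every `θ k` equals `1`, so the integrals along the path would tend to `1` for
  -- all `k`, against the choice of `k`.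
  have hgx : g • x ≠ x := by
    intro hgx
    have h1 : θ k x = 1 := by simp [θ, hgx]
    have h2 := (ENNReal.continuous_ofReal.tendsto _).comp (hx' (θ k))
    rw [h1, ENNReal.ofReal_one] at h2
    have h3 : Tendsto (fun n => ∫⁻ y, ENNReal.ofReal (θ k (ω n • y)) ∂η) atTop (𝓝 1) := by
      refine h2.congr fun n => ?_
      exact ofReal_integral_eq_lintegral_ofReal (hint _ _) (ae_of_all _ fun y => hθ0 k _)
    rw [h3.liminf_eq] at hk
    exact lt_irrefl _ hk
  obtain ⟨A, B, hA, hB, hgA, hxB, hAB⟩ := t2_separation hgx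
  set U := B ∩ (fun y => g • y) ⁻¹' A with hU
  have hUo : IsOpen U := hB.inter (hA.preimage (hcont g))
  obtain ⟨v, hv0, hv1, hv⟩ := exists_continuous_zero_one_of_isClosed hUo.isClosed_compl
    (isClosed_singleton (x := x)) (Set.disjoint_left.2 fun y hy hyx => hy (by
      rw [Set.mem_singleton_iff.1 hyx]; exact ⟨hxB, hgA⟩))
  have hvx : v x = 1 := hv1 rfl
  -- The maximum covers `r < 0`, where `ENNReal.ofReal r` is `0` and strict positivity is still
  -- required.
  have hr' : max r 0 < v x := by rw [hvx]; exact max_lt hr one_pos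
  filter_upwards [(hx' v).eventually_const_lt hr'] with n hn
  refine ⟨U, hUo.measurableSet, fun y hy hgy => Set.disjoint_left.1 hAB hy.2 hgy.1, ?_⟩
  have hUn : MeasurableSet {y | ω n • y ∈ U} := (hUo.preimage (hcont (ω n))).measurableSet
  have hle : ∫ y, v (ω n • y) ∂η ≤ η.real {y | ω n • y ∈ U} := by
    rw [← mul_one (η.real _), ← smul_eq_mul, ← integral_indicator_const _ hUn]
    refine integral_mono (hint v _) ((integrable_const _).indicator hUn) fun y => ?_
    by_cases hy : ω n • y ∈ U
    · simpa [hy] using (hv (ω n • y)).2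
    · simpa [hy] using (hv0 hy).le
  rw [← ofReal_measureReal, ENNReal.ofReal_lt_ofReal_iff']
  exact ⟨(le_max_left r 0).trans_lt (hn.trans_le hle), (le_max_right r 0).trans_lt (hn.trans_le hle)⟩

end BoundaryLimits

/-! ## Unique stationary boundaries and C*-simplicity -/

/-- A stationary state almost vanishes on a translate of `λ_g` by `h` if the translate by `h` of
the stationary measure is concentrated on a set displaced by `g`. -/
theorem IsStationaryFunctional.norm_apply_innerAction_le {Γ : Type*} [Group Γ] {μ : PMF Γ}
    {X M K : Type*} [MeasurableSpace X] [MulAction Γ X] [MeasurableConstSMul Γ X] {ν : Measure X}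
    (hν : IsNonsingularAction Γ ν)
    [MeasurableSpace M] [MulAction Γ M] [MeasurableConstSMul Γ M] {η : Measure M}
    (hM : IsoMeasuredAction Γ ν η)
    [TopologicalSpace K] [CompactSpace K] [T2Space K] [MeasurableSpace K] [BorelSpace K]
    [MulAction Γ K] [ContinuousConstSMul Γ K] {ρ : Measure K}
    (hK : IsoMeasuredAction Γ ν ρ) (hρ : IsUniqueStationaryMeasure μ ρ)
    {φ : ReducedCStar Γ →ₗ[ℂ] ℂ} (hφ : IsState φ) (hst : IsStationaryFunctional μ innerAction φ)
    {g h : Γ} {r : ℝ} {U : Set M} (hU : MeasurableSet U) (hdisp : ∀ x ∈ U, g • x ∉ U)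
    (hr : ENNReal.ofReal r < η {x | h • x ∈ U}) :
    ‖φ (innerAction h⁻¹ (leftRegular g : ReducedCStar Γ))‖ ≤ 2 * √(1 - r) := by
  obtain ⟨ψ, hψ, hψφ, hψst⟩ := IsState.exists_stationary_extension (S := ReducedCStar Γ)
    (β := innerAction) (α := conjTranslation)
    (fun g a => coe_innerAction_eq_conjTranslation g a) hφ hst
  obtain ⟨p, hp, hpη, hpeq, -, -⟩ := hM.exists_transport hν
  obtain ⟨q, hq, hqρ, -, -, hqW⟩ := hK.exists_transport hν
  -- `W` is the copy in `K` of `U`, transported through `X`; equivariance holds only almost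
  -- everywhere, so `W` is displaced only modulo `ρ`.
  obtain ⟨W, hW, hWV⟩ := hqW (p ⁻¹' U) (hp hU)
  rw [← hψφ, coe_innerAction_eq_conjTranslation, coe_leftRegular]
  have hWm : ∀ h : Γ, MeasurableSet {x | h • x ∈ W} := fun h => hW.preimage (measurable_const_smul h)
  have hWU : ∀ h : Γ, ∀ᵐ x ∂ν, h • q x ∈ W ↔ h • p x ∈ U := fun h => by
    filter_upwards [hWV h, hpeq h] with x h1 h2
    rw [h1, Set.mem_preimage, h2]
  refine hρ.norm_apply_conjTranslation_le_of_measure hψ hψst hW ?_ ?_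
  · have hm : MeasurableSet {x | h • x ∈ W ∧ (g * h) • x ∈ W} := (hWm h).inter (hWm (g * h))
    rw [← hqρ, Measure.map_apply hq hm, measure_eq_zero_iff_ae_notMem]
    filter_upwards [hWU h, hWU (g * h)] with x h1 h2 h3
    exact hdisp _ (h1.1 h3.1) (mul_smul g h (p x) ▸ h2.1 h3.2)
  · have hm : MeasurableSet {x | h • x ∈ U} := hU.preimage (measurable_const_smul h)
    rw [← hqρ, Measure.map_apply hq (hWm h)]
    rw [← hpη, Measure.map_apply hp hm] at hr
    refine hr.trans_eq (measure_congr ?_)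
    filter_upwards [hWU h] with x hx
    exact propext hx.symm

theorem theorem4p13 {Γ : Type u} [Group Γ] [Countable Γ]
    [MeasurableSpace Γ] [DiscreteMeasurableSpace Γ] (μ : PMF Γ)
    {X : Type v} [MeasurableSpace X] [MulAction Γ X] [MeasurableConstSMul Γ X] (ν : Measure X)
    (hUSB : IsUSB.{u, v, w, z} μ ν) (hfree : IsEssentiallyFree Γ ν) :
    IsCStarSimpleMeasure μ := by
  obtain ⟨⟨-, hns, -, M, _, _, _, _, _, _, _, η, _, hM, hη⟩,
    K, _, _, _, _, _, _, _, ρ, hK, hρ⟩ := hUSB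
  refine ⟨⟨isState_canonicalTrace, isStationaryFunctional_canonicalTrace μ⟩, fun φ hφ hst =>
    eq_of_eq_on_leftRegular hφ.continuous isState_canonicalTrace.continuous fun g => ?_⟩
  classical
  rw [canonicalTrace_leftRegular]
  split_ifs with hg
  · rw [hg, map_one]
    exact hφ.1
  -- Essential freeness passes to `M`: almost every point of `X` whose image is fixed by `g` is
  -- itself fixed.
  have hηfree : η {x | g • x = x} = 0 := by
    obtain ⟨p, hp, hpη, -, hfix, -⟩ := hM.exists_transport hns
    have hm : MeasurableSet {x : M | g • x = x} :=
      (isClosed_eq (continuous_const_smul g) continuous_id).measurableSet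
    rw [← hpη, Measure.map_apply hp hm, measure_eq_zero_iff_ae_notMem]
    filter_upwards [hfix g, measure_eq_zero_iff_ae_notMem.1 (hfree g hg)] with x h1 h2 h3
    exact h2 (h1 h3)
  let Q : Γ → ℂ := fun h => φ (innerAction h⁻¹ (leftRegular g : ReducedCStar Γ))
  have hQC : ∀ h, ‖Q h‖ ≤ ‖(leftRegular g : ReducedCStar Γ)‖ := fun h =>
    (hφ.norm_apply_le _).trans_eq (StarAlgEquiv.norm_map _ _)
  -- Since `(h * g)⁻¹ = g⁻¹ * h⁻¹`, harmonicity of `Q` at `h` is stationarity of `φ` at the element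
  -- `h⁻¹ · λ_g`.
  have hQ : ∀ h, HasSum (fun g => ((μ g).toReal : ℂ) * Q (h * g)) (Q h) := fun h => by
    simpa only [Q, mul_inv_rev, innerAction_mul_apply] using hst (innerAction h⁻¹ (leftRegular g))
  have hlim : ∀ᵐ ω ∂(pathMeasure μ), Tendsto (fun n => Q (ω n)) atTop (𝓝 0) := by
    filter_upwards [hη.ae_eventually_exists_displaced hηfree] with ω hω
    refine Metric.tendsto_nhds.2 fun ε hε => ?_
    -- With this `r`, the bound `2 √(1 - r)` is `ε / 2`.
    filter_upwards [hω (1 - (ε / 4) ^ 2) (by have := pow_pos hε 2; nlinarith)]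
      with n ⟨U, hU, hdisp, hr⟩
    have := hst.norm_apply_innerAction_le hns hM hK hρ hφ hU hdisp hr
    rw [sub_sub_cancel, Real.sqrt_sq (by positivity)] at this
    rw [dist_zero_right]
    exact this.trans_lt (by linarith)
  have hQm : ∀ n, AEStronglyMeasurable (fun ω : ℕ → Γ => Q (ω n)) (pathMeasure μ) := fun n =>
    ((measurable_of_countable Q).comp (measurable_pi_apply n)).aestronglyMeasurable
  have hint := tendsto_integral_of_dominated_convergence _ hQm
    (integrable_const ‖(leftRegular g : ReducedCStar Γ)‖)
    (fun n => ae_of_all _ fun ω => hQC (ω n)) hlim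
  simp only [integral_pathMeasure_of_harmonic μ hQC hQ, integral_zero] at hint
  simpa [Q] using tendsto_nhds_unique tendsto_const_nhds hint
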